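/- Let $d$ and $n$ be positive integers. The cells of the $d$-dimensional $n^d$ board are the points of $\{1,\dots,n\}^d$, and two distinct cells $c, c'$ are neighbours if $|c_i-c'_i|\le 1$ for every $i=1,\dots,d$. Suppose that the cells can be filled with integers, not all of them zero, in such a way that the entry of every cell equals the sum of the entries of its neighbouring cells. Then $3\mid n+1$. -/

import Mathlib

/-- The graph of neighbouring cells of the `d`-dimensional `n × ⋯ × n` board. The cells are the
points of `Fin d → Fin n`, and two distinct cells are neighbours when the corresponding unit cubes
touch (at least in a common vertex), that is, when all their coordinates differ by at most `1`.
For `d = 2` this is the king's graph. -/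
def boardGraph (d n : ℕ) : SimpleGraph (Fin d → Fin n) where
  Adj c c' := c ≠ c' ∧ ∀ i, |((c i : ℕ) : ℤ) - ((c' i : ℕ) : ℤ)| ≤ 1
  symm := ⟨fun _ _ h => ⟨h.1.symm, fun i => by rw [abs_sub_comm]; exact h.2 i⟩⟩
  loopless := ⟨fun _ h => h.1 rfl⟩

instance boardGraph.decidableAdj (d n : ℕ) : DecidableRel (boardGraph d n).Adj :=
  fun c c' => inferInstanceAs
    (Decidable (c ≠ c' ∧ ∀ i, |((c i : ℕ) : ℤ) - ((c' i : ℕ) : ℤ)| ≤ 1))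

/-- The filling `x` of the board with integers has the neighbour-sum property: every entry is the
sum of the entries of the neighbouring cells. -/
def NeighbourSum {d n : ℕ} (x : (Fin d → Fin n) → ℤ) : Prop :=
  ∀ c, x c = ∑ c' ∈ (boardGraph d n).neighborFinset c, x c'

/-!
The entries form a vector in the kernel of `1 - A`, where `A` is the adjacency matrix of the board,
so it suffices that `det (1 - A)` is odd when `3 ∤ n + 1`. Modulo `2` the matrix `1 - A = 1 + A`
sums over closed neighbourhoods, hence is the `d`-fold Kronecker power of the matrix that does so
on a path with `n` vertices. The latter is injective: a sequence vanishing at `0` and `n + 1` in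
which any three consecutive terms sum to zero is `3`-periodic, so it vanishes unless `3 ∣ n + 1`.
-/

section Periodicity

variable {M : Type*} [AddMonoid M] {n : ℕ} {g : ℕ → M}

theorem apply_eq_apply_mod_three (hg : ∀ i < n, g i + g (i + 1) + g (i + 2) = 0) :
    ∀ i ≤ n + 1, g i = g (i % 3)
  | 0, _ | 1, _ | 2, _ => rfl
  | i + 3, hi => by
    have hleft : g i + (g (i + 1) + g (i + 2)) = 0 := by rw [← add_assoc, hg i (by omega)]
    have hright : g (i + 1) + g (i + 2) + g (i + 3) = 0 := hg (i + 1) (by omega)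
    rw [← left_neg_eq_right_neg hleft hright, Nat.add_mod_right]
    exact apply_eq_apply_mod_three hg i (by omega)

theorem eq_zero_of_add_add_eq_zero (hn : ¬ 3 ∣ n + 1) (hzero : g 0 = 0) (hlast : g (n + 1) = 0)
    (hg : ∀ i < n, g i + g (i + 1) + g (i + 2) = 0) (i : ℕ) (hi : i ≤ n + 1) : g i = 0 := by
  have hmod := apply_eq_apply_mod_three hg
  have hlast' : g ((n + 1) % 3) = 0 := hmod (n + 1) le_rfl ▸ hlast
  have hsum (h : 0 < n) : g 1 + g 2 = 0 := by simpa [hzero] using hg 0 h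
  have hone : g 1 = 0 := by
    obtain h | h : (n + 1) % 3 = 1 ∨ (n + 1) % 3 = 2 := by omega
    · rwa [h] at hlast'
    · simpa [h ▸ hlast'] using hsum (by omega)
  rw [hmod i hi]
  obtain h | h | h : i % 3 = 0 ∨ i % 3 = 1 ∨ i % 3 = 2 := by omega
  · rwa [h]
  · rwa [h]
  · simpa [h, hone] using hsum (by omega)

end Periodicity

section TrivialSumKernel

/-- The `0`-`1` matrix of the relation `r` has trivial kernel on families in `M`. The entries of `M`
are only added, so the product of the matrix with `f` is written as sums over `{b | r a b}`. -/
def TrivialSumKernel {α : Type*} [Fintype α] (r : α → α → Prop) [DecidableRel r]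
    (M : Type*) [AddCommMonoid M] : Prop :=
  ∀ f : α → M, (∀ a, ∑ b with r a b, f b = 0) → f = 0

variable {M : Type*} [AddCommMonoid M]

theorem sum_filter_forall_cons {d : ℕ} {α : Fin (d + 1) → Type*} [∀ i, Fintype (α i)]
    (p : ∀ i, α i → Prop) [∀ i, DecidablePred (p i)] (x : (∀ i, α i) → M) :
    ∑ c with ∀ i, p i (c i), x c =
      ∑ c : ∀ i : Fin d, α i.succ with ∀ i, p i.succ (c i), ∑ b with p 0 b, x (Fin.cons b c) := by
  rw [Finset.sum_comm]
  simp only [Finset.sum_filter]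
  rw [← (Fin.consEquiv α).sum_comp, Fintype.sum_prod_type]
  refine Finset.sum_congr rfl fun b _ => ?_
  by_cases hb : p 0 b <;> simp [Fin.consEquiv, Fin.forall_fin_succ, hb]

theorem TrivialSumKernel.pi : ∀ {d : ℕ} {α : Fin d → Type*} [∀ i, Fintype (α i)]
    {r : ∀ i, α i → α i → Prop} [∀ i, DecidableRel (r i)],
    (∀ i, TrivialSumKernel (r i) M) →
      TrivialSumKernel (fun c c' : ∀ i, α i => ∀ i, r i (c i) (c' i)) M
  | 0, _, _, _, _, _ => fun x hx => by
    funext c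
    simpa [Subsingleton.elim default c] using hx c
  | d + 1, α, _, r, _, hr => fun x hx => by
    have hslice (a : α 0) : (fun c : ∀ i : Fin d, α i.succ =>
        ∑ b with r 0 a b, x (Fin.cons b c)) = 0 := by
      refine TrivialSumKernel.pi (fun i : Fin d => hr i.succ) _ fun c => ?_
      simpa only [Fin.cons_zero, Fin.cons_succ] using
        (sum_filter_forall_cons (fun i => r i (Fin.cons a c i)) x).symm.trans (hx (Fin.cons a c))
    funext c
    have hline := hr 0 (fun b => x (Fin.cons b (Fin.tail c)))
      fun a => congrFun (hslice a) (Fin.tail c)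
    simpa using congrFun hline (c 0)

/-- The family `f`, placed at the indices `1, …, n` and extended by zero, so that the sum over the
closed neighbourhood of any vertex of the path, including the end points, has three terms. -/
def zeroExtend {n : ℕ} (f : Fin n → M) (i : ℕ) : M :=
  ∑ b : Fin n, if (b : ℕ) + 1 = i then f b else 0

theorem zeroExtend_succ {n : ℕ} (f : Fin n → M) (b : Fin n) : zeroExtend f (b + 1) = f b := by
  simp [zeroExtend, Fin.val_inj]

theorem zeroExtend_zero {n : ℕ} (f : Fin n → M) : zeroExtend f 0 = 0 := by
  simp [zeroExtend]

theorem zeroExtend_last {n : ℕ} (f : Fin n → M) : zeroExtend f (n + 1) = 0 :=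
  Finset.sum_eq_zero fun b _ => if_neg (by omega)

theorem zeroExtend_add_add {n : ℕ} (f : Fin n → M) (a : Fin n) :
    zeroExtend f a + zeroExtend f (a + 1) + zeroExtend f (a + 2) =
      ∑ b ∈ Finset.univ.filter fun b : Fin n => |((a : ℕ) : ℤ) - ((b : ℕ) : ℤ)| ≤ 1, f b := by
  simp only [zeroExtend, ← Finset.sum_add_distrib, Finset.sum_filter, abs_le]
  refine Finset.sum_congr rfl fun b _ => ?_
  split_ifs <;> first | omega | simp

theorem trivialSumKernel_path {n : ℕ} (hn : ¬ 3 ∣ n + 1) :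
    TrivialSumKernel (fun a b : Fin n => |((a : ℕ) : ℤ) - ((b : ℕ) : ℤ)| ≤ 1) M := by
  intro f hf
  funext b
  rw [← zeroExtend_succ f b]
  exact eq_zero_of_add_add_eq_zero hn (zeroExtend_zero f) (zeroExtend_last f)
    (fun i hi => (zeroExtend_add_add f ⟨i, hi⟩).trans (hf ⟨i, hi⟩)) _ (by omega)

end TrivialSumKernel

section Determinant

open Matrix
open scoped Matrix.Module

variable {ι : Type*} [Fintype ι] [DecidableEq ι]

theorem not_dvd_det_of_smul_zmod {p : ℕ} [Fact p.Prime] {A : Matrix ι ι ℤ}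
    (hA : ∀ v : ι → ZMod p, A • v = 0 → v = 0) : ¬ (p : ℤ) ∣ A.det := by
  have hmulVec (v : ι → ZMod p) : A.map (Int.cast : ℤ → ZMod p) *ᵥ v = A • v := by
    ext i
    simp [mulVec, dotProduct, Matrix.Module.smul_apply]
  have hdet : (A.map (Int.cast : ℤ → ZMod p)).det ≠ 0 := fun h =>
    let ⟨v, hv, hAv⟩ := exists_mulVec_eq_zero_iff.mpr h
    hv (hA v (hmulVec v ▸ hAv))
  rwa [← ZMod.intCast_zmod_eq_zero_iff_dvd, Int.cast_det]

theorem det_smul_eq_zero_of_smul_eq_zero {R M : Type*} [CommRing R] [AddCommGroup M] [Module R M]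
    {A : Matrix ι ι R} {x : ι → M} (hx : A • x = 0) : A.det • x = 0 := by
  calc A.det • x = (A.adjugate * A) • x := by rw [adjugate_mul, smul_assoc, one_smul]
    _ = 0 := by rw [mul_smul, hx, smul_zero]

theorem eq_zero_of_odd_zsmul_eq_zero {M : Type*} [AddGroup M]
    (hM : ∀ a : M, Odd (addOrderOf a) → a = 0) {m : ℤ} (hm : Odd m) {a : M} (ha : m • a = 0) :
    a = 0 :=
  hM a <| hm.natAbs.of_dvd_nat <| Int.natCast_dvd.mp <| addOrderOf_dvd_iff_zsmul_eq_zero.mpr ha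

end Determinant

section IsNeighbourSum

/-- The neighbour-sum property `NeighbourSum` for the vertices of an arbitrary finite graph and
entries in an arbitrary additive monoid. -/
def IsNeighbourSum {V M : Type*} [Fintype V] [AddCommMonoid M] (G : SimpleGraph V)
    [DecidableRel G.Adj] (x : V → M) : Prop :=
  ∀ v, x v = ∑ w ∈ G.neighborFinset v, x w

variable {V M : Type*} [Fintype V] {G : SimpleGraph V} [DecidableRel G.Adj] [AddCommGroup M]

open scoped Matrix.Module in
theorem isNeighbourSum_iff_smul_eq_zero [DecidableEq V] {x : V → M} :
    IsNeighbourSum G x ↔ (1 - G.adjMatrix ℤ) • x = 0 := by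
  simp [IsNeighbourSum, funext_iff, sub_smul, Matrix.Module.smul_apply, sub_eq_zero,
    SimpleGraph.adjMatrix_apply, ite_smul, ← Finset.sum_filter,
    SimpleGraph.neighborFinset_eq_filter]

theorem IsNeighbourSum.eq_zero_of_zmod_two (hG : ∀ y : V → ZMod 2, IsNeighbourSum G y → y = 0)
    (hM : ∀ a : M, Odd (addOrderOf a) → a = 0) {x : V → M} (hx : IsNeighbourSum G x) : x = 0 := by
  classical
  have hodd : Odd (1 - G.adjMatrix ℤ).det := by
    rw [← Int.not_even_iff_odd, even_iff_two_dvd]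
    exact not_dvd_det_of_smul_zmod fun y hy => hG y (isNeighbourSum_iff_smul_eq_zero.mpr hy)
  have hdet : (1 - G.adjMatrix ℤ).det • x = 0 :=
    det_smul_eq_zero_of_smul_eq_zero (isNeighbourSum_iff_smul_eq_zero.mp hx)
  funext v
  exact eq_zero_of_odd_zsmul_eq_zero hM hodd (congrFun hdet v)

end IsNeighbourSum

theorem sum_closedNeighbourhood_boardGraph {M : Type*} [AddCommMonoid M] {d n : ℕ}
    (x : (Fin d → Fin n) → M) (c : Fin d → Fin n) :
    ∑ c' with ∀ i, |((c i : ℕ) : ℤ) - ((c' i : ℕ) : ℤ)| ≤ 1, x c' =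
      x c + ∑ c' ∈ (boardGraph d n).neighborFinset c, x c' := by
  have hclosed : (Finset.univ.filter fun c' : Fin d → Fin n =>
      ∀ i, |((c i : ℕ) : ℤ) - ((c' i : ℕ) : ℤ)| ≤ 1) =
        insert c ((boardGraph d n).neighborFinset c) := by
    ext c'
    obtain rfl | hne := eq_or_ne c c'
    · simp
    · simp only [Finset.mem_filter_univ, Finset.mem_insert, SimpleGraph.mem_neighborFinset,
        hne.symm, false_or]
      exact (and_iff_right hne).symm
  rw [hclosed, Finset.sum_insert (by simp)]

theorem eq_zero_of_isNeighbourSum_boardGraph_zmod_two {d n : ℕ} (hn : ¬ 3 ∣ n + 1)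
    {y : (Fin d → Fin n) → ZMod 2} (hy : IsNeighbourSum (boardGraph d n) y) : y = 0 := by
  refine TrivialSumKernel.pi (fun _ => trivialSumKernel_path hn) y fun c => ?_
  rw [sum_closedNeighbourhood_boardGraph, ← hy c, CharTwo.add_self_eq_zero]

/-- Elements of infinite order do not violate `hM`: their `addOrderOf` is `0`, which is even. -/
theorem mainTheorem6_general {M : Type*} [AddCommGroup M]
    (hM : ∀ a : M, Odd (addOrderOf a) → a = 0) (d n : ℕ)
    (h : ∃ x : (Fin d → Fin n) → M, x ≠ 0 ∧ IsNeighbourSum (boardGraph d n) x) :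
    3 ∣ n + 1 := by
  by_contra hn
  obtain ⟨x, hx0, hx⟩ := h
  exact hx0 (hx.eq_zero_of_zmod_two (fun _ => eq_zero_of_isNeighbourSum_boardGraph_zmod_two hn) hM)

theorem mainTheorem6 (d n : ℕ)
    (h : ∃ x : (Fin d → Fin n) → ℤ, x ≠ 0 ∧ NeighbourSum x) :
    3 ∣ n + 1 :=
  mainTheorem6_general (fun a ha => (isOfFinAddOrder_iff_eq_zero a).mp <|
    addOrderOf_pos_iff.mp ha.pos) d n h
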